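/- Let $n\ge 1$ be an integer and let $0\le j\le \ell$ be integers. There is a constant $C=C(n,j,\ell)>0$ such that the following holds for every $L>0$ and every closed plane curve of total length $L$ and rotation number $n$, given by an $L$-periodic arc-length parametrization $f:\mathbb{R}\to\mathbb{R}^2$ of class $C^{\ell+2}$ (so $|f'|\equiv 1$). Let $\nu$ be the unit normal obtained by rotating $f'$ counter-clockwise by $\pi/2$, let $\kappa=f''\cdot\nu$ be the curvature, so that having rotation number $n$ means $\frac1{2\pi}\int_0^L\kappa\,ds=n$, and set \[ \tilde\kappa=\kappa-\frac1L\int_0^L\kappa\,ds,\qquad I_m=L^{2m+1}\int_0^L\bigl|\partial_s^m\tilde\kappa\bigr|^2\,ds\quad(0\le m\le\ell), \] \[ \widetilde I_{-1}=\frac1L\int_0^L\Bigl|\frac{2\pi n}{L}\Bigl(f-\frac1L\int_0^L f\,ds\Bigr)+\nu\Bigr|^2ds . \] Then \[ I_j\le C\Bigl(\widetilde I_{-1}^{\,\frac{\ell-j}{2}}\,I_\ell+\widetilde I_{-1}^{\,\frac{\ell-j}{\ell+1}}\,I_\ell^{\,\frac{j+1}{\ell+1}}\Bigr), \] where $0^0=1$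 (this matters only for $j=\ell$). In particular, $C$ does not depend on $L$ or on the curve. -/

import Mathlib

noncomputable section

namespace PlaneCurve

/-- `f` is an arc-length parametrization, of class `C^m`, of a closed plane curve of total
length `L`. The plane `ℝ²` is identified with `ℂ` through `(f₁, f₂) ↦ f₁ + i f₂`, and functions
on `ℝ / Lℤ` are `L`-periodic functions on `ℝ`. -/
structure IsClosedCurve (m : ℕ) (L : ℝ) (f : ℝ → ℂ) : Prop where
  length_pos : 0 < L
  contDiff : ContDiff ℝ m f
  periodic : Function.Periodic f L
  unit_speed : ∀ s, ‖deriv f s‖ = 1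

/-- The unit tangent vector `∂ₛ f`. -/
def tangent (f : ℝ → ℂ) (s : ℝ) : ℂ := deriv f s

/-- The unit normal vector: the tangent rotated counter-clockwise by `π / 2`. -/
def normal (f : ℝ → ℂ) (s : ℝ) : ℂ := Complex.I * tangent f s

/-- The curvature vector `∂ₛ² f`. -/
def curvatureVector (f : ℝ → ℂ) (s : ℝ) : ℂ := deriv (tangent f) s

/-- The signed curvature: the Euclidean inner product of the curvature vector with the normal. -/
def curvature (f : ℝ → ℂ) (s : ℝ) : ℝ := inner ℝ (curvatureVector f s) (normal f s)

/-- The deviation of the curvature from its mean. -/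
def curvatureDeviation (L : ℝ) (f : ℝ → ℂ) (s : ℝ) : ℝ :=
  curvature f s - 1 / L * ∫ t in (0 : ℝ)..L, curvature f t

/-- The rotation number `(1 / 2π) ∫₀ᴸ κ ds`. -/
def rotationNumber (L : ℝ) (f : ℝ → ℂ) : ℝ :=
  1 / (2 * Real.pi) * ∫ s in (0 : ℝ)..L, curvature f s

/-- The scale-invariant quantity `I_ℓ = L^{2ℓ+1} ∫₀ᴸ |∂ₛ^ℓ κ̃|² ds`. -/
def energy (ℓ : ℕ) (L : ℝ) (f : ℝ → ℂ) : ℝ :=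
  L ^ (2 * ℓ + 1) * ∫ s in (0 : ℝ)..L, |iteratedDeriv ℓ (curvatureDeviation L f) s| ^ 2

/-- The quantity `Ĩ₋₁ = (1 / L) ‖(2πn / L) (f - (1 / L) ∫₀ᴸ f ds) + ν‖²` with the `L²(0, L)` norm,
where `n` is the rotation number of `f`. -/
def circleDeficit (L : ℝ) (f : ℝ → ℂ) : ℝ :=
  1 / L * ∫ s in (0 : ℝ)..L,
    ‖(2 * Real.pi * rotationNumber L f / L) • (f s - (1 / L) • ∫ t in (0 : ℝ)..L, f t)
      + normal f s‖ ^ 2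

end PlaneCurve

end

/-! Let g be the vector field whose mean square is `circleDeficit`. Since ν' = -κτ and the mean of κ
is 2πn/L, one has g' = -κ̃τ. Integrating by parts on the closed curve gives ∫κ̃² = ∫⟨g, (κ̃τ)'⟩ =
∫⟨g, κ̃κν + κ̃'τ⟩. As κ̃ has mean zero, |κ̃| ≤ √I₁/L, and Cauchy-Schwarz yields I₀ ≤ √D((1 + 2πn)√I₁
+ I₁) with D the deficit (`energy_zero_le`).

If I₁ dominates √I₁, this reads I₀ ≤ c√D I₁; otherwise I₀² ≤ c²D I₁. The sequence I_m is log-convex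
(`energy_sq_le`), so either bound on I₀ by I₁ propagates to a bound on I_j by I_ℓ. The two cases
produce the two terms of the estimate. -/

open intervalIntegral

/-! ### L² inequalities for functions on an interval -/

/-- The Cauchy-Schwarz inequality for continuous functions on an interval. -/
theorem sq_intervalIntegral_mul_le {u v : ℝ → ℝ} {a b : ℝ} (hab : a ≤ b)
    (hu : Continuous u) (hv : Continuous v) :
    (∫ s in a..b, u s * v s) ^ 2 ≤ (∫ s in a..b, u s ^ 2) * ∫ s in a..b, v s ^ 2 := by
  have key : ∀ x : ℝ, 0 ≤ (∫ s in a..b, v s ^ 2) * (x * x)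
      + (2 * ∫ s in a..b, u s * v s) * x + ∫ s in a..b, u s ^ 2 := by
    intro x
    have h : ∫ s in a..b, (x * v s + u s) ^ 2 = (∫ s in a..b, v s ^ 2) * (x * x)
        + (2 * ∫ s in a..b, u s * v s) * x + ∫ s in a..b, u s ^ 2 := by
      have e : ∀ s, (x * v s + u s) ^ 2 = (x * x) * v s ^ 2 + (2 * x) * (u s * v s) + u s ^ 2 :=
        fun s => by ring
      simp_rw [e]
      rw [integral_add, integral_add, integral_const_mul, integral_const_mul]
      · ring
      all_goals exact Continuous.intervalIntegrable (by fun_prop) _ _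
    rw [← h]
    exact integral_nonneg hab fun s _ => sq_nonneg _
  have := discrim_le_zero key
  unfold discrim at this
  linarith

theorem abs_intervalIntegral_mul_le {u v : ℝ → ℝ} {a b : ℝ} (hab : a ≤ b)
    (hu : Continuous u) (hv : Continuous v) :
    |∫ s in a..b, u s * v s| ≤ √(∫ s in a..b, u s ^ 2) * √(∫ s in a..b, v s ^ 2) := by
  rw [← Real.sqrt_mul (integral_nonneg hab fun s _ => sq_nonneg _)]
  exact Real.abs_le_sqrt (sq_intervalIntegral_mul_le hab hu hv)

theorem Function.Periodic.deriv_of_real {F : Type*} [NormedAddCommGroup F] [NormedSpace ℝ F]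
    {u : ℝ → F} {L : ℝ} (h : Function.Periodic u L) : Function.Periodic (deriv u) L := by
  intro s
  rw [← deriv_comp_add_const]
  congr 1
  exact funext h

theorem Function.Periodic.iteratedDeriv_of_real {u : ℝ → ℝ} {L : ℝ}
    (h : Function.Periodic u L) (m : ℕ) : Function.Periodic (iteratedDeriv m u) L := by
  induction m with
  | zero => simpa using h
  | succ m ih => rw [iteratedDeriv_succ]; exact ih.deriv_of_real

/-- Log-convexity in `m` of the squared norms `‖∂ᵐ u‖²` of a periodic function. -/
theorem sq_integral_sq_iteratedDeriv_le {u : ℝ → ℝ} {L : ℝ} (hL : 0 ≤ L) {m : ℕ}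
    (hu : ContDiff ℝ (m + 2 : ℕ) u) (hp : Function.Periodic u L) :
    (∫ s in (0 : ℝ)..L, iteratedDeriv (m + 1) u s ^ 2) ^ 2 ≤
      (∫ s in (0 : ℝ)..L, iteratedDeriv m u s ^ 2)
        * ∫ s in (0 : ℝ)..L, iteratedDeriv (m + 2) u s ^ 2 := by
  have hc : ∀ i ≤ m + 2, Continuous (iteratedDeriv i u) := fun i hi =>
    hu.continuous_iteratedDeriv i (by exact_mod_cast hi)
  have hd : ∀ i < m + 2, ∀ s, HasDerivAt (iteratedDeriv i u) (iteratedDeriv (i + 1) u s) s := by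
    intro i hi s
    rw [iteratedDeriv_succ]
    exact (hu.differentiable_iteratedDeriv i (by exact_mod_cast hi) s).hasDerivAt
  have hz : ∀ i, iteratedDeriv i u L = iteratedDeriv i u 0 := fun i => by
    simpa using hp.iteratedDeriv_of_real i 0
  -- Integrate ∂ᵐu · ∂ᵐ⁺²u by parts; periodicity cancels the boundary terms.
  have key := integral_mul_deriv_eq_deriv_mul (a := 0) (b := L)
    (fun s _ => hd m (by omega) s) (fun s _ => hd (m + 1) (by omega) s)
    ((hc (m + 1) (by omega)).intervalIntegrable _ _) ((hc (m + 2) le_rfl).intervalIntegrable _ _)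
  rw [hz, hz, sub_self, zero_sub] at key
  simp_rw [← pow_two] at key
  rw [← neg_sq, ← key]
  exact sq_intervalIntegral_mul_le hL (hc m (by omega)) (hc (m + 2) le_rfl)

/-- A function with vanishing mean is bounded by the `L²` norm of its derivative. -/
theorem abs_le_sqrt_of_integral_eq_zero {u u' : ℝ → ℝ} {L : ℝ} (hL : 0 < L)
    (hu : ∀ s, HasDerivAt u (u' s) s) (hu' : Continuous u') (h0 : ∫ s in (0 : ℝ)..L, u s = 0)
    {s : ℝ} (hs : s ∈ Set.Icc 0 L) : |u s| ≤ √L * √(∫ t in (0 : ℝ)..L, u' t ^ 2) := by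
  have hc : Continuous u := continuous_iff_continuousAt.2 fun t => (hu t).continuousAt
  -- Without a zero, u has constant sign on the interval and its mean cannot vanish.
  obtain ⟨t, ht, hut⟩ : ∃ t ∈ Set.Icc 0 L, u t = 0 := by
    by_contra! hne
    have hconn : IsPreconnected (u '' Set.Icc 0 L) := isPreconnected_Icc.image _ hc.continuousOn
    have h00 : (0 : ℝ) ∉ u '' Set.Icc 0 L := by
      rintro ⟨t, ht, h⟩
      exact hne t ht h
    have hsign : (∀ t ∈ Set.Icc 0 L, 0 < u t) ∨ ∀ t ∈ Set.Icc 0 L, u t < 0 := by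
      by_contra! hcon
      obtain ⟨⟨x, hx, hx'⟩, y, hy, hy'⟩ := hcon
      exact h00 (hconn.ordConnected.out ⟨x, hx, rfl⟩ ⟨y, hy, rfl⟩ ⟨hx', hy'⟩)
    rcases hsign with h | h
    · have := intervalIntegral_pos_of_pos_on (hc.intervalIntegrable 0 L)
        (fun t ht => h t (Set.Ioo_subset_Icc_self ht)) hL
      linarith
    · have := intervalIntegral_pos_of_pos_on (hc.neg.intervalIntegrable 0 L)
        (fun t ht => neg_pos.2 (h t (Set.Ioo_subset_Icc_self ht))) hL
      simp only [Pi.neg_apply, intervalIntegral.integral_neg] at this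
      linarith
  have h1 : u s = ∫ x in t..s, u' x := by
    rw [integral_eq_sub_of_hasDerivAt (fun x _ => hu x) (hu'.intervalIntegrable _ _), hut, sub_zero]
  have h2 : |u s| ≤ ∫ x in (0 : ℝ)..L, 1 * |u' x| := by
    simp_rw [one_mul]
    rw [h1]
    refine (Real.norm_eq_abs _).symm.trans_le ?_
    refine (norm_integral_le_abs_integral_norm (f := u') (a := t) (b := s)
      (μ := MeasureTheory.volume)).trans ?_
    simp only [Real.norm_eq_abs]
    refine (abs_integral_mono_interval (c := 0) (d := L) (a := t) (b := s) ?_ ?_ ?_).trans ?_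
    · rw [Set.uIoc_of_le hL.le]
      exact Set.Ioc_subset_Ioc (le_min ht.1 hs.1) (max_le ht.2 hs.2)
    · exact Filter.Eventually.of_forall fun x => abs_nonneg _
    · exact hu'.abs.intervalIntegrable _ _
    · rw [abs_of_nonneg (integral_nonneg hL.le fun x _ => abs_nonneg _)]
  refine h2.trans ((le_abs_self _).trans ?_)
  refine (abs_intervalIntegral_mul_le hL.le continuous_const hu'.abs).trans_eq ?_
  simp

/-! ### Log-convex sequences -/

/-- Interpolation for finite log-convex sequences. -/
theorem pow_le_mul_pow_of_logConvex {E : ℕ → ℝ} (hE : ∀ m, 0 ≤ E m) {ℓ : ℕ}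
    (h : ∀ m, m + 2 ≤ ℓ → E (m + 1) ^ 2 ≤ E m * E (m + 2)) {j : ℕ} (hj : j ≤ ℓ) :
    E j ^ ℓ ≤ E 0 ^ (ℓ - j) * E ℓ ^ j := by
  -- The case j = ℓ - 1 at each level. Stating it with powers instead of ratios allows zero terms.
  have step : ∀ m, m + 1 ≤ ℓ → E m ^ (m + 1) ≤ E 0 * E (m + 1) ^ m := by
    intro m
    induction m with
    | zero => intro _; simp
    | succ m ih =>
      intro hm
      have h1 := ih (by omega)
      rcases (hE (m + 1)).eq_or_lt with h0 | h0
      · rw [← h0, zero_pow (by omega)]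
        exact mul_nonneg (hE _) (pow_nonneg (hE _) _)
      · refine le_of_mul_le_mul_left ?_ (pow_pos h0 m)
        calc E (m + 1) ^ m * E (m + 1) ^ (m + 1 + 1) = (E (m + 1) ^ 2) ^ (m + 1) := by ring
          _ ≤ (E m * E (m + 2)) ^ (m + 1) := pow_le_pow_left₀ (sq_nonneg _) (h m hm) _
          _ = E m ^ (m + 1) * E (m + 2) ^ (m + 1) := mul_pow _ _ _
          _ ≤ E 0 * E (m + 1) ^ m * E (m + 2) ^ (m + 1) :=
            mul_le_mul_of_nonneg_right h1 (pow_nonneg (hE _) _)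
          _ = E (m + 1) ^ m * (E 0 * E (m + 1 + 1) ^ (m + 1)) := by ring
  obtain ⟨d, rfl⟩ := Nat.exists_eq_add_of_le hj
  clear hj
  induction d with
  | zero => simp
  | succ d ih =>
    rcases Nat.eq_zero_or_pos (j + d) with h0 | h0
    · obtain ⟨rfl, rfl⟩ : j = 0 ∧ d = 0 := by omega
      simp
    have h1 := ih (fun m hm => h m (by omega)) (fun m hm => step m (by omega))
    have h2 := step (j + d) (by omega)
    rw [Nat.add_sub_cancel_left] at h1 ⊢
    -- The power j + d makes E (j + d) appear to the exponent j + d + 1, to which `step` applies.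
    refine (pow_le_pow_iff_left₀ (pow_nonneg (hE _) _)
      (mul_nonneg (pow_nonneg (hE _) _) (pow_nonneg (hE _) _)) h0.ne').1 ?_
    calc (E j ^ (j + (d + 1))) ^ (j + d) = (E j ^ (j + d)) ^ (j + d + 1) := by
          rw [← pow_mul, ← pow_mul, mul_comm, add_assoc]
      _ ≤ (E 0 ^ d * E (j + d) ^ j) ^ (j + d + 1) :=
          pow_le_pow_left₀ (pow_nonneg (hE _) _) h1 _
      _ = E 0 ^ (d * (j + d + 1)) * (E (j + d) ^ (j + d + 1)) ^ j := by
          rw [mul_pow, ← pow_mul, ← pow_mul, ← pow_mul, mul_comm j]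
      _ ≤ E 0 ^ (d * (j + d + 1)) * (E 0 * E (j + d + 1) ^ (j + d)) ^ j := by
          have := pow_nonneg (hE 0) (d * (j + d + 1))
          have := pow_nonneg (hE (j + d)) (j + d + 1)
          gcongr
      _ = (E 0 ^ (d + 1) * E (j + (d + 1)) ^ j) ^ (j + d) := by
          rw [← add_assoc]
          ring

/-- Combination of log-convexity with a bound of the lowest term by the next one. -/
theorem le_of_logConvex_of_le {E : ℕ → ℝ} (hE : ∀ m, 0 ≤ E m) {ℓ : ℕ} (hℓ : 1 ≤ ℓ)
    (h : ∀ m, m + 2 ≤ ℓ → E (m + 1) ^ 2 ≤ E m * E (m + 2)) {j : ℕ} (hj : j ≤ ℓ)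
    {K : ℝ} (h0 : E 0 ≤ K * E 1) (hK : 0 ≤ K) : E j ≤ K ^ (ℓ - j) * E ℓ := by
  have hj' := pow_le_mul_pow_of_logConvex hE h hj
  have h1 := pow_le_mul_pow_of_logConvex hE h hℓ
  -- Interpolating E 1 between E 0 and E ℓ leaves E 0 ^ (ℓ - 1) on both sides, which cancels.
  have hl : E 0 ≤ K ^ ℓ * E ℓ := by
    rcases (hE 0).eq_or_lt with hz | hz
    · rw [← hz]; exact mul_nonneg (pow_nonneg hK _) (hE _)
    refine le_of_mul_le_mul_left ?_ (pow_pos hz (ℓ - 1))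
    calc E 0 ^ (ℓ - 1) * E 0 = E 0 ^ ℓ := by rw [← pow_succ, Nat.sub_add_cancel hℓ]
      _ ≤ (K * E 1) ^ ℓ := pow_le_pow_left₀ hz.le h0 _
      _ = K ^ ℓ * E 1 ^ ℓ := mul_pow _ _ _
      _ ≤ K ^ ℓ * (E 0 ^ (ℓ - 1) * E ℓ ^ 1) := mul_le_mul_of_nonneg_left h1 (pow_nonneg hK _)
      _ = E 0 ^ (ℓ - 1) * (K ^ ℓ * E ℓ) := by ring
  refine (pow_le_pow_iff_left₀ (hE _) (mul_nonneg (pow_nonneg hK _) (hE _))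
    (by omega : ℓ ≠ 0)).1 ?_
  calc E j ^ ℓ ≤ E 0 ^ (ℓ - j) * E ℓ ^ j := hj'
    _ ≤ (K ^ ℓ * E ℓ) ^ (ℓ - j) * E ℓ ^ j :=
      mul_le_mul_of_nonneg_right (pow_le_pow_left₀ (hE 0) hl _) (pow_nonneg (hE _) _)
    _ = K ^ (ℓ * (ℓ - j)) * E ℓ ^ (ℓ - j + j) := by rw [mul_pow, pow_add]; ring
    _ = (K ^ (ℓ - j) * E ℓ) ^ ℓ := by rw [Nat.sub_add_cancel hj]; ring

/-- Combination of log-convexity with a bound of the square of the lowest term by the next one. -/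
theorem pow_le_of_logConvex_of_sq_le {E : ℕ → ℝ} (hE : ∀ m, 0 ≤ E m) {ℓ : ℕ} (hℓ : 1 ≤ ℓ)
    (h : ∀ m, m + 2 ≤ ℓ → E (m + 1) ^ 2 ≤ E m * E (m + 2)) {j : ℕ} (hj : j ≤ ℓ)
    {K : ℝ} (h0 : E 0 ^ 2 ≤ K * E 1) (hK : 0 ≤ K) :
    E j ^ (ℓ + 1) ≤ K ^ (ℓ - j) * E ℓ ^ (j + 1) := by
  have hj' := pow_le_mul_pow_of_logConvex hE h hj
  have h1 := pow_le_mul_pow_of_logConvex hE h hℓ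
  have hl : E 0 ^ (ℓ + 1) ≤ K ^ ℓ * E ℓ := by
    rcases (hE 0).eq_or_lt with hz | hz
    · rw [← hz, zero_pow (by omega)]; exact mul_nonneg (pow_nonneg hK _) (hE _)
    refine le_of_mul_le_mul_left ?_ (pow_pos hz (ℓ - 1))
    calc E 0 ^ (ℓ - 1) * E 0 ^ (ℓ + 1) = (E 0 ^ 2) ^ ℓ := by
          rw [← pow_add, ← pow_mul]; congr 1; omega
      _ ≤ (K * E 1) ^ ℓ := pow_le_pow_left₀ (sq_nonneg _) h0 _
      _ = K ^ ℓ * E 1 ^ ℓ := mul_pow _ _ _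
      _ ≤ K ^ ℓ * (E 0 ^ (ℓ - 1) * E ℓ ^ 1) := mul_le_mul_of_nonneg_left h1 (pow_nonneg hK _)
      _ = E 0 ^ (ℓ - 1) * (K ^ ℓ * E ℓ) := by ring
  refine (pow_le_pow_iff_left₀ (pow_nonneg (hE _) _)
    (mul_nonneg (pow_nonneg hK _) (pow_nonneg (hE _) _)) (by omega : ℓ ≠ 0)).1 ?_
  obtain ⟨d, rfl⟩ := Nat.exists_eq_add_of_le hj
  rw [Nat.add_sub_cancel_left] at hj' ⊢
  calc (E j ^ (j + d + 1)) ^ (j + d) = (E j ^ (j + d)) ^ (j + d + 1) := pow_right_comm _ _ _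
    _ ≤ (E 0 ^ d * E (j + d) ^ j) ^ (j + d + 1) := pow_le_pow_left₀ (pow_nonneg (hE _) _) hj' _
    _ = (E 0 ^ (j + d + 1)) ^ d * E (j + d) ^ (j * (j + d + 1)) := by
      rw [mul_pow, pow_right_comm, pow_mul]
    _ ≤ (K ^ (j + d) * E (j + d)) ^ d * E (j + d) ^ (j * (j + d + 1)) :=
      mul_le_mul_of_nonneg_right (pow_le_pow_left₀ (pow_nonneg (hE 0) _) hl _)
        (pow_nonneg (hE _) _)
    _ = (K ^ d * E (j + d) ^ (j + 1)) ^ (j + d) := by ring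

/-! ### Frenet equations and energies of a closed curve -/

namespace PlaneCurve

theorem IsClosedCurve.mono {m k : ℕ} {L : ℝ} {f : ℝ → ℂ} (h : IsClosedCurve m L f) (hk : k ≤ m) :
    IsClosedCurve k L f :=
  ⟨h.length_pos, h.contDiff.of_le (by exact_mod_cast hk), h.periodic, h.unit_speed⟩

theorem IsClosedCurve.contDiff_tangent {m : ℕ} {L : ℝ} {f : ℝ → ℂ}
    (h : IsClosedCurve (m + 1) L f) : ContDiff ℝ m (tangent f) := by
  have := h.contDiff
  push_cast at this
  exact this.deriv'

theorem IsClosedCurve.contDiff_curvature {m : ℕ} {L : ℝ} {f : ℝ → ℂ}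
    (h : IsClosedCurve (m + 2) L f) : ContDiff ℝ m (curvature f) := by
  have h1 : ContDiff ℝ (m + 1 : ℕ) (tangent f) := h.contDiff_tangent
  have h2 : ContDiff ℝ m (curvatureVector f) := by
    push_cast at h1
    exact h1.deriv'
  exact h2.inner ℝ (contDiff_const.mul (h1.of_le (by exact_mod_cast Nat.le_succ m)))

theorem IsClosedCurve.contDiff_curvatureDeviation {m : ℕ} {L : ℝ} {f : ℝ → ℂ}
    (h : IsClosedCurve (m + 2) L f) : ContDiff ℝ m (curvatureDeviation L f) :=
  h.contDiff_curvature.sub contDiff_const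

theorem IsClosedCurve.periodic_tangent {m : ℕ} {L : ℝ} {f : ℝ → ℂ}
    (h : IsClosedCurve m L f) : Function.Periodic (tangent f) L :=
  h.periodic.deriv_of_real

theorem IsClosedCurve.periodic_normal {m : ℕ} {L : ℝ} {f : ℝ → ℂ}
    (h : IsClosedCurve m L f) : Function.Periodic (normal f) L := fun s => by
  rw [normal, normal, h.periodic_tangent s]

theorem IsClosedCurve.periodic_curvatureDeviation {m : ℕ} {L : ℝ} {f : ℝ → ℂ}
    (h : IsClosedCurve m L f) : Function.Periodic (curvatureDeviation L f) L := fun s => by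
  have : curvatureVector f (s + L) = curvatureVector f s := h.periodic_tangent.deriv_of_real s
  rw [curvatureDeviation, curvatureDeviation, curvature, curvature, this, h.periodic_normal s]

/-- The Frenet equation for the tangent. -/
theorem IsClosedCurve.hasDerivAt_tangent {m : ℕ} {L : ℝ} {f : ℝ → ℂ}
    (h : IsClosedCurve (m + 2) L f) (s : ℝ) :
    HasDerivAt (tangent f) (curvature f s • normal f s) s := by
  have h1 : ContDiff ℝ (m + 1 : ℕ) (tangent f) := h.contDiff_tangent
  have hd : HasDerivAt (tangent f) (curvatureVector f s) s :=
    (h1.differentiable (by simp) s).hasDerivAt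
  have hconst : ∀ t, inner ℝ (tangent f t) (tangent f t) = 1 := fun t => by
    rw [real_inner_self_eq_norm_sq, tangent, h.unit_speed]; norm_num
  have hin := hd.inner ℝ hd
  simp_rw [hconst] at hin
  have horth := hin.unique (hasDerivAt_const s (1 : ℝ))
  have hone := hconst s
  convert hd using 1
  -- In coordinates: if |q| = 1 and p ⊥ q, then p is its own projection onto iq.
  simp only [curvature, normal, Complex.inner] at horth hone ⊢
  generalize curvatureVector f s = p at *
  generalize tangent f s = q at *
  apply Complex.ext <;> simp at horth hone ⊢
  · linear_combination p.re * hone - q.re / 2 * horth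
  · linear_combination p.im * hone - q.im / 2 * horth

/-- The Frenet equation for the normal. -/
theorem IsClosedCurve.hasDerivAt_normal {m : ℕ} {L : ℝ} {f : ℝ → ℂ}
    (h : IsClosedCurve (m + 2) L f) (s : ℝ) :
    HasDerivAt (normal f) (-(curvature f s • tangent f s)) s := by
  refine HasDerivAt.congr_deriv (f := normal f)
    ((h.hasDerivAt_tangent s).const_mul Complex.I) ?_
  rw [Complex.real_smul, Complex.real_smul, normal]
  linear_combination ((curvature f s : ℂ) * tangent f s) * Complex.I_sq

theorem IsClosedCurve.norm_normal {m : ℕ} {L : ℝ} {f : ℝ → ℂ} (h : IsClosedCurve m L f) (s : ℝ) :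
    ‖normal f s‖ = 1 := by
  rw [normal, norm_mul, Complex.norm_I, one_mul]
  exact h.unit_speed s

theorem IsClosedCurve.curvatureDeviation_eq {m : ℕ} {L : ℝ} {f : ℝ → ℂ}
    (_ : IsClosedCurve m L f) (s : ℝ) :
    curvatureDeviation L f s = curvature f s - 2 * Real.pi * rotationNumber L f / L := by
  rw [curvatureDeviation, rotationNumber]
  field_simp

theorem IsClosedCurve.integral_curvatureDeviation {m : ℕ} {L : ℝ} {f : ℝ → ℂ}
    (h : IsClosedCurve (m + 2) L f) : ∫ s in (0 : ℝ)..L, curvatureDeviation L f s = 0 := by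
  have hL := h.length_pos.ne'
  simp only [curvatureDeviation]
  rw [integral_sub (h.contDiff_curvature.continuous.intervalIntegrable _ _)
    intervalIntegrable_const, integral_const]
  simp only [sub_zero, smul_eq_mul]
  field_simp
  ring

theorem IsClosedCurve.energy_nonneg {m : ℕ} {L : ℝ} {f : ℝ → ℂ} (h : IsClosedCurve m L f)
    (i : ℕ) : 0 ≤ energy i L f :=
  mul_nonneg (pow_nonneg h.length_pos.le _)
    (integral_nonneg h.length_pos.le fun _ _ => sq_nonneg _)

theorem IsClosedCurve.circleDeficit_nonneg {m : ℕ} {L : ℝ} {f : ℝ → ℂ}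
    (h : IsClosedCurve m L f) : 0 ≤ circleDeficit L f :=
  mul_nonneg (one_div_nonneg.2 h.length_pos.le)
    (integral_nonneg h.length_pos.le fun _ _ => sq_nonneg _)

/-- The weights L^(2m+1) are geometric in m, so log-convexity of the integrals passes to the
energies. -/
theorem IsClosedCurve.energy_sq_le {m : ℕ} {L : ℝ} {f : ℝ → ℂ}
    (h : IsClosedCurve (m + 2 + 2) L f) :
    energy (m + 1) L f ^ 2 ≤ energy m L f * energy (m + 2) L f := by
  have := sq_integral_sq_iteratedDeriv_le h.length_pos.le h.contDiff_curvatureDeviation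
    h.periodic_curvatureDeviation
  simp only [energy, sq_abs]
  have hL := pow_nonneg h.length_pos.le (4 * m + 6)
  calc _ = L ^ (4 * m + 6) *
        (∫ s in (0 : ℝ)..L, iteratedDeriv (m + 1) (curvatureDeviation L f) s ^ 2) ^ 2 := by ring
    _ ≤ _ := mul_le_mul_of_nonneg_left this hL
    _ = _ := by ring

/-! ### The circle defect controls the lowest energy -/

/-- The integrand of `circleDeficit`. -/
noncomputable def circleDefect (L : ℝ) (f : ℝ → ℂ) (s : ℝ) : ℂ :=
  (2 * Real.pi * rotationNumber L f / L) • (f s - (1 / L) • ∫ t in (0 : ℝ)..L, f t) + normal f s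

theorem IsClosedCurve.hasDerivAt_circleDefect {m : ℕ} {L : ℝ} {f : ℝ → ℂ}
    (h : IsClosedCurve (m + 2) L f) (s : ℝ) :
    HasDerivAt (circleDefect L f) (-(curvatureDeviation L f s • tangent f s)) s := by
  have hf : HasDerivAt f (tangent f s) s :=
    (h.contDiff.differentiable (by simp) s).hasDerivAt
  refine HasDerivAt.congr_deriv (f := circleDefect L f)
    (((hf.sub_const _).const_smul (2 * Real.pi * rotationNumber L f / L)).add
      (h.hasDerivAt_normal s)) ?_
  rw [h.curvatureDeviation_eq, sub_smul]
  abel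

theorem IsClosedCurve.periodic_circleDefect {m : ℕ} {L : ℝ} {f : ℝ → ℂ}
    (h : IsClosedCurve m L f) : Function.Periodic (circleDefect L f) L := fun s => by
  rw [circleDefect, circleDefect, h.periodic s, h.periodic_normal s]

/-- Integrate the derivative of ⟨g, κ̃τ⟩ over a period, g being the circle defect: g' = -κ̃τ
contributes -κ̃², and (κ̃τ)' gives the right-hand side. -/
theorem integral_sq_curvatureDeviation_eq {L : ℝ} {f : ℝ → ℂ} (h : IsClosedCurve (1 + 2) L f) :
    ∫ s in (0 : ℝ)..L, curvatureDeviation L f s ^ 2 =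
      ∫ s in (0 : ℝ)..L, inner ℝ (circleDefect L f s)
        (curvatureDeviation L f s • (curvature f s • normal f s)
          + deriv (curvatureDeviation L f) s • tangent f s) := by
  have hk : ContDiff ℝ (1 : ℕ) (curvatureDeviation L f) := h.contDiff_curvatureDeviation
  have hkd : ∀ s, HasDerivAt (curvatureDeviation L f) (deriv (curvatureDeviation L f) s) s :=
    fun s => (hk.differentiable (by simp) s).hasDerivAt
  have hk' : Continuous (deriv (curvatureDeviation L f)) := hk.continuous_deriv (by simp)
  have hκ : Continuous (curvature f) := h.contDiff_curvature.continuous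
  have hτ : Continuous (tangent f) :=
    continuous_iff_continuousAt.2 fun s => (h.hasDerivAt_tangent s).continuousAt
  have hν : Continuous (normal f) :=
    continuous_iff_continuousAt.2 fun s => (h.hasDerivAt_normal s).continuousAt
  have hg : Continuous (circleDefect L f) :=
    continuous_iff_continuousAt.2 fun s => (h.hasDerivAt_circleDefect s).continuousAt
  have hkc := hk.continuous
  have hd := fun s => (h.hasDerivAt_circleDefect s).inner ℝ ((hkd s).smul (h.hasDerivAt_tangent s))
  have key := integral_eq_sub_of_hasDerivAt (a := 0) (b := L) (fun s _ => hd s)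
    (Continuous.intervalIntegrable (by fun_prop) _ _)
  rw [integral_add (Continuous.intervalIntegrable (by fun_prop) _ _)
    (Continuous.intervalIntegrable (by fun_prop) _ _)] at key
  have e1 : circleDefect L f L = circleDefect L f 0 := by simpa using h.periodic_circleDefect 0
  have e2 : curvatureDeviation L f L = curvatureDeviation L f 0 := by
    simpa using h.periodic_curvatureDeviation 0
  have e3 : tangent f L = tangent f 0 := by simpa using h.periodic_tangent 0
  have e4 : ∀ s, inner ℝ (-(curvatureDeviation L f s • tangent f s))
      ((curvatureDeviation L f • tangent f) s) = -curvatureDeviation L f s ^ 2 := by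
    intro s
    rw [Pi.smul_apply', inner_neg_left, real_inner_self_eq_norm_sq, norm_smul, tangent,
      h.unit_speed, mul_one, Real.norm_eq_abs, sq_abs]
  simp_rw [e4] at key
  rw [Pi.smul_apply', Pi.smul_apply', e1, e2, e3, sub_self, intervalIntegral.integral_neg] at key
  linarith

/-- This is the only geometric input to the interpolation. The sup bound on κ̃ handles the factor
κ̃κ, and Cauchy-Schwarz then pairs the defect with 1 and with κ̃'. -/
theorem energy_zero_le {L : ℝ} {f : ℝ → ℂ} (h : IsClosedCurve (1 + 2) L f) :
    energy 0 L f ≤ √(circleDeficit L f) *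
      ((1 + 2 * Real.pi * |rotationNumber L f|) * √(energy 1 L f) + energy 1 L f) := by
  have hL := h.length_pos
  have hk : ContDiff ℝ (1 : ℕ) (curvatureDeviation L f) := h.contDiff_curvatureDeviation
  have hkd : ∀ s, HasDerivAt (curvatureDeviation L f) (deriv (curvatureDeviation L f) s) s :=
    fun s => (hk.differentiable (by simp) s).hasDerivAt
  have hk' : Continuous (deriv (curvatureDeviation L f)) := hk.continuous_deriv (by simp)
  have hκ : Continuous (curvature f) := h.contDiff_curvature.continuous
  have hτ : Continuous (tangent f) :=
    continuous_iff_continuousAt.2 fun s => (h.hasDerivAt_tangent s).continuousAt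
  have hν : Continuous (normal f) :=
    continuous_iff_continuousAt.2 fun s => (h.hasDerivAt_normal s).continuousAt
  have hg : Continuous (circleDefect L f) :=
    continuous_iff_continuousAt.2 fun s => (h.hasDerivAt_circleDefect s).continuousAt
  have hkc := hk.continuous
  set r := 2 * Real.pi * |rotationNumber L f| with hr
  have hr0 : 0 ≤ r := by positivity
  set e := √(energy 1 L f) with he
  have he0 : 0 ≤ e := Real.sqrt_nonneg _
  set d := √(circleDeficit L f) with hd
  have hee : e ^ 2 = energy 1 L f := Real.sq_sqrt (h.energy_nonneg 1)
  have hdd : d ^ 2 = circleDeficit L f := Real.sq_sqrt h.circleDeficit_nonneg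
  have hE1 : ∫ s in (0 : ℝ)..L, deriv (curvatureDeviation L f) s ^ 2 = e ^ 2 / L ^ 3 := by
    rw [hee, energy]
    simp only [sq_abs, iteratedDeriv_one]
    field_simp
  have hE0 : energy 0 L f = L * ∫ s in (0 : ℝ)..L, curvatureDeviation L f s ^ 2 := by
    simp [energy]
  have hD : ∫ s in (0 : ℝ)..L, ‖circleDefect L f s‖ ^ 2 = L * d ^ 2 := by
    rw [hdd, circleDeficit]
    simp only [circleDefect]
    field_simp
  -- the curvature deviation is at most `e / L`
  have hsup : ∀ s ∈ Set.Icc 0 L, |curvatureDeviation L f s| ≤ e / L := by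
    intro s hs
    refine (abs_le_sqrt_of_integral_eq_zero hL hkd hk' h.integral_curvatureDeviation hs).trans_eq ?_
    rw [hE1, ← Real.sqrt_mul hL.le, show L * (e ^ 2 / L ^ 3) = (e / L) ^ 2 by field_simp]
    exact Real.sqrt_sq (by positivity)
  have hκk : ∀ s, |curvature f s| ≤ |curvatureDeviation L f s| + r / L := by
    intro s
    have e1 : curvature f s = curvatureDeviation L f s + 2 * Real.pi * rotationNumber L f / L := by
      rw [h.curvatureDeviation_eq]; ring
    rw [e1]
    refine (abs_add_le _ _).trans_eq ?_
    rw [abs_div, abs_mul, abs_of_pos hL, abs_of_pos Real.two_pi_pos]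
  have hpt : ∀ s ∈ Set.Icc 0 L, inner ℝ (circleDefect L f s)
        (curvatureDeviation L f s • (curvature f s • normal f s)
          + deriv (curvatureDeviation L f) s • tangent f s) ≤
      (e / L * (e / L + r / L)) * (‖circleDefect L f s‖ * 1)
        + ‖circleDefect L f s‖ * |deriv (curvatureDeviation L f) s| := by
    intro s hs
    refine (real_inner_le_norm _ _).trans ?_
    have h1 : ‖curvatureDeviation L f s • (curvature f s • normal f s)
          + deriv (curvatureDeviation L f) s • tangent f s‖ ≤
        e / L * (e / L + r / L) + |deriv (curvatureDeviation L f) s| := by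
      refine (norm_add_le _ _).trans ?_
      rw [norm_smul, norm_smul, norm_smul, h.norm_normal, tangent, h.unit_speed, mul_one, mul_one,
        Real.norm_eq_abs, Real.norm_eq_abs, Real.norm_eq_abs]
      gcongr
      · exact hsup s hs
      · exact (hκk s).trans (by linarith [hsup s hs])
    calc _ ≤ ‖circleDefect L f s‖
          * (e / L * (e / L + r / L) + |deriv (curvatureDeviation L f) s|) := by gcongr
      _ = _ := by ring
  have hint1 : ∫ s in (0 : ℝ)..L, ‖circleDefect L f s‖ * 1 ≤ L * d := by
    refine (le_abs_self _).trans
      ((abs_intervalIntegral_mul_le hL.le hg.norm continuous_const).trans_eq ?_)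
    rw [hD, ← Real.sqrt_mul (by positivity)]
    simp only [one_pow, intervalIntegral.integral_const, sub_zero, smul_eq_mul, mul_one]
    rw [show L * d ^ 2 * L = (L * d) ^ 2 by ring]
    exact Real.sqrt_sq (by positivity)
  have hint2 : ∫ s in (0 : ℝ)..L, ‖circleDefect L f s‖ * |deriv (curvatureDeviation L f) s|
      ≤ d * e / L := by
    refine (le_abs_self _).trans
      ((abs_intervalIntegral_mul_le hL.le hg.norm hk'.abs).trans_eq ?_)
    simp only [sq_abs]
    rw [hD, hE1, ← Real.sqrt_mul (by positivity),
      show L * d ^ 2 * (e ^ 2 / L ^ 3) = (d * e / L) ^ 2 by field_simp]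
    exact Real.sqrt_sq (by positivity)
  have hmain : ∫ s in (0 : ℝ)..L, curvatureDeviation L f s ^ 2 ≤
      (e / L * (e / L + r / L)) * (L * d) + d * e / L := by
    rw [integral_sq_curvatureDeviation_eq h]
    refine (integral_mono_on hL.le (Continuous.intervalIntegrable (by fun_prop) _ _)
      (Continuous.intervalIntegrable (by fun_prop) _ _) hpt).trans ?_
    rw [integral_add (Continuous.intervalIntegrable (by fun_prop) _ _)
      (Continuous.intervalIntegrable (by fun_prop) _ _), integral_const_mul]
    gcongr
  rw [hE0, ← hee]
  refine (mul_le_mul_of_nonneg_left hmain hL.le).trans_eq ?_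
  field_simp
  ring

end PlaneCurve

/-! ### The interpolation inequality -/

theorem mainTheorem3 (n : ℕ) (hn : 1 ≤ n) (j ℓ : ℕ) (hj : j ≤ ℓ) :
    ∃ C : ℝ, 0 < C ∧ ∀ (L : ℝ) (f : ℝ → ℂ),
      PlaneCurve.IsClosedCurve (ℓ + 2) L f → PlaneCurve.rotationNumber L f = (n : ℝ) →
        PlaneCurve.energy j L f ≤
          C * (PlaneCurve.circleDeficit L f ^ (((ℓ : ℝ) - (j : ℝ)) / 2) * PlaneCurve.energy ℓ L f
            + PlaneCurve.circleDeficit L f ^ (((ℓ : ℝ) - (j : ℝ)) / ((ℓ : ℝ) + 1))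
              * PlaneCurve.energy ℓ L f ^ (((j : ℝ) + 1) / ((ℓ : ℝ) + 1))) := by
  -- The 2 absorbs the sum of the two terms in `energy_zero_le`, once one dominates the other.
  set c : ℝ := 2 * (1 + 2 * Real.pi * n) with hc
  have hc1 : 1 ≤ c := by
    have : 0 ≤ Real.pi * n := mul_nonneg Real.pi_pos.le n.cast_nonneg
    linarith
  have hc0 : 0 < c := by linarith
  have hcle : 1 ≤ 1 + 2 * Real.pi * n := le_add_of_nonneg_right (by positivity)
  refine ⟨c ^ (2 * ℓ), by positivity, fun L f h hrot => ?_⟩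
  set D := PlaneCurve.circleDeficit L f with hDdef
  have hD : 0 ≤ D := h.circleDeficit_nonneg
  have hE : ∀ m, 0 ≤ PlaneCurve.energy m L f := h.energy_nonneg
  have hlc : ∀ m, m + 2 ≤ ℓ → PlaneCurve.energy (m + 1) L f ^ 2 ≤
      PlaneCurve.energy m L f * PlaneCurve.energy (m + 2) L f := fun m hm =>
    (h.mono (by omega)).energy_sq_le
  have hT1 : 0 ≤ D ^ (((ℓ : ℝ) - (j : ℝ)) / 2) * PlaneCurve.energy ℓ L f :=
    mul_nonneg (Real.rpow_nonneg hD _) (hE ℓ)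
  have hT2 : 0 ≤ D ^ (((ℓ : ℝ) - (j : ℝ)) / ((ℓ : ℝ) + 1))
      * PlaneCurve.energy ℓ L f ^ (((j : ℝ) + 1) / ((ℓ : ℝ) + 1)) :=
    mul_nonneg (Real.rpow_nonneg hD _) (Real.rpow_nonneg (hE ℓ) _)
  suffices PlaneCurve.energy j L f ≤
        c ^ (ℓ - j) * (D ^ (((ℓ : ℝ) - (j : ℝ)) / 2) * PlaneCurve.energy ℓ L f) ∨
      PlaneCurve.energy j L f ≤ c ^ (2 * (ℓ - j)) *
        (D ^ (((ℓ : ℝ) - (j : ℝ)) / ((ℓ : ℝ) + 1))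
          * PlaneCurve.energy ℓ L f ^ (((j : ℝ) + 1) / ((ℓ : ℝ) + 1))) by
    rw [mul_add]
    rcases this with h | h
    · refine h.trans ((mul_le_mul_of_nonneg_right
        (pow_le_pow_right₀ hc1 (by omega : ℓ - j ≤ 2 * ℓ)) hT1).trans ?_)
      exact le_add_of_nonneg_right (by positivity)
    · refine h.trans ((mul_le_mul_of_nonneg_right
        (pow_le_pow_right₀ hc1 (by omega : 2 * (ℓ - j) ≤ 2 * ℓ)) hT2).trans ?_)
      exact le_add_of_nonneg_left (by positivity)
  -- For j = ℓ the exponent of D is 0. Otherwise ℓ ≥ 1, so the curve is C³, as `energy_zero_le`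
  -- requires.
  rcases hj.eq_or_lt with rfl | hjl
  · left
    simp
  have hℓ : 1 ≤ ℓ := by omega
  have hcast : ((ℓ - j : ℕ) : ℝ) = (ℓ : ℝ) - j := Nat.cast_sub hj
  have h0 := PlaneCurve.energy_zero_le (h.mono (by omega : 1 + 2 ≤ ℓ + 2))
  rw [hrot, abs_of_nonneg n.cast_nonneg, ← hDdef] at h0
  rcases le_total (PlaneCurve.energy 1 L f) (√(PlaneCurve.energy 1 L f)) with h1 | h1
  · right
    have h2 : PlaneCurve.energy 0 L f ≤ c * (√D * √(PlaneCurve.energy 1 L f)) := by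
      refine h0.trans ?_
      rw [mul_left_comm]
      refine mul_le_mul_of_nonneg_left ?_ (Real.sqrt_nonneg _)
      have := le_mul_of_one_le_left (Real.sqrt_nonneg (PlaneCurve.energy 1 L f)) hcle
      rw [hc, mul_assoc]
      linarith
    have h3 : PlaneCurve.energy 0 L f ^ 2 ≤ (c ^ 2 * D) * PlaneCurve.energy 1 L f := by
      refine (pow_le_pow_left₀ (hE 0) h2 2).trans_eq ?_
      rw [mul_pow c, mul_pow √D, Real.sq_sqrt hD, Real.sq_sqrt (hE 1), mul_assoc]
    have h4 := pow_le_of_logConvex_of_sq_le hE hℓ hlc hj h3 (by positivity)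
    have hp : (0 : ℝ) < (ℓ : ℝ) + 1 := by positivity
    refine (pow_le_pow_iff_left₀ (hE j) (mul_nonneg (by positivity) hT2)
      (Nat.succ_ne_zero ℓ)).1 (h4.trans ?_)
    have e1 : (D ^ (((ℓ : ℝ) - (j : ℝ)) / ((ℓ : ℝ) + 1))) ^ (ℓ + 1) = D ^ (ℓ - j) := by
      rw [← Real.rpow_natCast, ← Real.rpow_mul hD, ← Real.rpow_natCast D, hcast]
      congr 1
      push_cast
      field_simp
    have e2 : (PlaneCurve.energy ℓ L f ^ (((j : ℝ) + 1) / ((ℓ : ℝ) + 1))) ^ (ℓ + 1)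
        = PlaneCurve.energy ℓ L f ^ (j + 1) := by
      rw [← Real.rpow_natCast, ← Real.rpow_mul (hE ℓ), ← Real.rpow_natCast _ (j + 1)]
      congr 1
      push_cast
      field_simp
    rw [mul_pow _ _ (ℓ + 1), mul_pow _ _ (ℓ + 1), e1, e2, mul_pow, ← pow_mul, mul_assoc]
    refine mul_le_mul_of_nonneg_right ?_ (mul_nonneg (pow_nonneg hD _) (pow_nonneg (hE ℓ) _))
    -- The true constant is c^(2(ℓ-j)/(ℓ+1)); since c ≥ 1 the root can be dropped.
    exact le_self_pow₀ (one_le_pow₀ hc1) (Nat.succ_ne_zero ℓ)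
  · left
    have h2 : PlaneCurve.energy 0 L f ≤ (c * √D) * PlaneCurve.energy 1 L f := by
      refine h0.trans ?_
      rw [mul_comm c, mul_assoc √D]
      refine mul_le_mul_of_nonneg_left ?_ (Real.sqrt_nonneg _)
      have : (1 + 2 * Real.pi * n) * √(PlaneCurve.energy 1 L f)
          ≤ (1 + 2 * Real.pi * n) * PlaneCurve.energy 1 L f :=
        mul_le_mul_of_nonneg_left h1 (by linarith)
      have := le_mul_of_one_le_left (hE 1) hcle
      rw [hc, mul_assoc]
      linarith
    have h4 := le_of_logConvex_of_le hE hℓ hlc hj h2 (by positivity)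
    have e1 : √D ^ (ℓ - j) = D ^ (((ℓ : ℝ) - (j : ℝ)) / 2) := by
      rw [Real.sqrt_eq_rpow, ← Real.rpow_natCast, ← Real.rpow_mul hD, hcast]
      congr 1
      ring
    rwa [mul_pow, e1, mul_assoc] at h4
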